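/- Let $\Lambda\subset\mathbb C^2$ be a lattice (a discrete subgroup spanning $\mathbb C^2$ over $\mathbb R$) and suppose that the complex torus $T=\mathbb C^2/\Lambda$ is simple, i.e. its only complex subtori are $\{0\}$ and $T$. Fix a Hermitian metric on $T$. A Brody curve in $T$ is a non-constant holomorphic map $f:\mathbb C\to T$ with $\|f'(\zeta)\|\le\|f'(0)\|$ for all $\zeta\in\mathbb C$. Let $S\subset T$ be a compact complex curve, i.e. a nonempty compact analytic subset of pure dimension $1$ (possibly singular or reducible); equivalently, a nonempty compact subset that near each of its points is the zero set of a single holomorphic function which does not vanish identically near that point. Then: (1) for every Brody curve $f:\mathbb C\to T$, the intersection $f(\mathbb C)\cap S$ is infinite; (2) for every finite set $D\subset T$, the complement $T\setminus S$ has the property of hyperbolic non-percolation through $D$, i.e. there is no Brody curve $g:\mathbb C\to T$ with $g(\mathbb C)\subset(T\setminus S)\cup D$. -/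

import Mathlib

open scoped Manifold ContDiff Topology

/-- The complex vector space `ℂ²`, with its standard Hermitian norm. -/
abbrev C2 : Type := EuclideanSpace ℂ (Fin 2)

/-- The quotient `ℂ² / Λ`, with the quotient topology and the quotient group structure. It is a
complex 2-dimensional torus when `Λ` is a lattice, i.e. a discrete subgroup that spans `ℂ²`
over `ℝ`. -/
abbrev ComplexTorus (Λ : Submodule ℤ C2) : Type := C2 ⧸ Λ.toAddSubgroup

namespace ComplexTorus

/-- The projection `ℂ² → ℂ² / Λ`. -/
abbrev proj (Λ : Submodule ℤ C2) : C2 → ComplexTorus Λ :=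
  QuotientAddGroup.mk (s := Λ.toAddSubgroup)

theorem isCoveringMap_proj (Λ : Submodule ℤ C2) [DiscreteTopology Λ] :
    IsCoveringMap (proj Λ) :=
  (AddSubgroup.isAddQuotientCoveringMap_of_comm Λ.toAddSubgroup
    (SetLike.isDiscrete_iff_discreteTopology.mpr ‹DiscreteTopology Λ›)).isCoveringMap

/-- The quotient manifold structure of `ℂ² / Λ`: its charts are local inverses of the projection
`ℂ² → ℂ² / Λ`. -/
noncomputable instance instChartedSpace (Λ : Submodule ℤ C2) [DiscreteTopology Λ] :
    ChartedSpace C2 (ComplexTorus Λ) :=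
  (isCoveringMap_proj Λ).isLocalHomeomorph.chartedSpace QuotientAddGroup.mk_surjective

variable (Λ : Submodule ℤ C2)

/-- A complex subtorus of `ℂ² / Λ`: the image of a complex linear subspace `W` of `ℂ²`,
provided that this image is compact (equivalently, that `Λ ∩ W` is a lattice in `W`). -/
def IsSubtorus (X : Set (ComplexTorus Λ)) : Prop :=
  (∃ W : Submodule ℂ C2, X = proj Λ '' (W : Set C2)) ∧ IsCompact X

/-- A complex torus is simple if its only complex subtori are `0` and the torus itself. -/
def IsSimple : Prop :=
  ∀ X : Set (ComplexTorus Λ), IsSubtorus Λ X → X = {0} ∨ X = Set.univ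

variable [DiscreteTopology Λ]

/-- A compact complex curve in the complex surface `ℂ² / Λ` (it may be singular or reducible):
a nonempty compact subset which near each of its points is the zero set of one holomorphic
function that does not vanish identically near that point. In a complex surface
these are exactly the nonempty compact analytic subsets of pure dimension one. -/
def IsCompactCurve (S : Set (ComplexTorus Λ)) : Prop :=
  S.Nonempty ∧ IsCompact S ∧
    ∀ p ∈ S, ∃ U : Set (ComplexTorus Λ), IsOpen U ∧ p ∈ U ∧
      ∃ g : ComplexTorus Λ → ℂ, MDifferentiableOn 𝓘(ℂ, C2) 𝓘(ℂ, ℂ) g U ∧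
        (¬ ∀ᶠ q in 𝓝 p, g q = 0) ∧ S ∩ U = {q ∈ U | g q = 0}

/-- A (smooth) Hermitian metric on `ℂ² / Λ`. All charts are local inverses of the projection
from `ℂ²` and differ by translations, so each tangent space is canonically `ℂ²`, and the metric
is a positive definite Hermitian form on `ℂ²` that depends smoothly on the base point. -/
structure HermitianMetric where
  /-- The form at a point, conjugate-linear in the first argument. -/
  form : ComplexTorus Λ → C2 →L⋆[ℂ] C2 →L[ℂ] ℂ
  symm : ∀ x v w, form x w v = starRingEnd ℂ (form x v w)
  pos : ∀ x v, v ≠ 0 → 0 < (form x v v).re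
  smooth : ContMDiff 𝓘(ℝ, C2) 𝓘(ℝ, C2 →L⋆[ℂ] C2 →L[ℂ] ℂ) ∞ form

variable {Λ}

/-- The length of a tangent vector `v` at the point `x`. -/
noncomputable def HermitianMetric.length (h : HermitianMetric Λ) (x : ComplexTorus Λ) (v : C2) :
    ℝ :=
  √(h.form x v v).re

/-- The complex derivative `f'(ζ)` of a map `f : ℂ → ℂ² / Λ`, a tangent vector at `f ζ`. -/
noncomputable def velocity (f : ℂ → ComplexTorus Λ) (ζ : ℂ) : C2 :=
  mfderiv 𝓘(ℂ, ℂ) 𝓘(ℂ, C2) f ζ (1 : ℂ)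

/-- A Brody curve for the Hermitian metric `h`: a non-constant entire holomorphic curve `f`
such that `‖f'(ζ)‖ ≤ ‖f'(0)‖` for all `ζ`. -/
structure IsBrodyCurve (h : HermitianMetric Λ) (f : ℂ → ComplexTorus Λ) : Prop where
  holomorphic : MDifferentiable 𝓘(ℂ, ℂ) 𝓘(ℂ, C2) f
  nonconstant : ¬ ∃ c, ∀ ζ, f ζ = c
  bound : ∀ ζ, h.length (f ζ) (velocity f ζ) ≤ h.length (f 0) (velocity f 0)

/-- `X` has the property of hyperbolic non-percolation through `D`: there are no Brody curves
with values in `X ∪ D`. -/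
def HyperbolicNonPercolation (h : HermitianMetric Λ) (X D : Set (ComplexTorus Λ)) : Prop :=
  ¬ ∃ g : ℂ → ComplexTorus Λ, IsBrodyCurve h g ∧ Set.range g ⊆ X ∪ D

end ComplexTorus

/-!
The lift of a Brody curve to `ℂ²` has bounded derivative, because the torus is compact, so by
Liouville's theorem the curve is the image of an affine line (`IsBrodyCurve.exists_eq_line`). It is
therefore enough to study how lines in a fixed direction `v` meet the curve `S`.

Write `L` for the image of `ℂ v` in the torus. By simplicity `L` is not compact, and therefore
the translates of the line `ℂ v` by the lattice accumulate at this line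
(`IsSimple.frequently_mem_lineForm_image`). Hence no line has an open piece inside `S`: by the
identity theorem `S` would contain the whole line, hence all its translates by the lattice, and a
local equation of `S` would vanish identically (`IsCompactCurve.not_eventually_line_mem`). By the
maximum principle, intersection points of lines with `S` then persist on nearby parallel lines
(`IsCompactCurve.eventually_exists_line_mem`), so that `S + L` is open. An open set absorbs closures,
`S + L = S + closure L`, and the right-hand side is closed since `S` is compact. The torus being
connected, `S + L` is everything: every line meets `S` (`IsCompactCurve.exists_line_mem`).

If a line met `S` in finitely many points only, its arbitrarily large discs would avoid `S`, as
otherwise the line would be the sum of a finite set and the image of a disc, and `L` would be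
compact. A limit of the centres of such discs gives a line that meets `S`, and the intersection
point persists on the discs, a contradiction (`IsCompactCurve.infinite_range_line_inter`). The
second claim follows from the first.
-/

open Set Filter Pointwise

/-! ### Zeros of holomorphic functions on parallel lines -/

/-- Zeros persist: if a holomorphic function vanishes at `z` but not identically on the line through
`z` in the direction `v`, then it has zeros close to `z` on all nearby parallel lines. -/
theorem eventually_exists_zero_on_line {E : Type*} [NormedAddCommGroup E] [NormedSpace ℂ E]
    {g : E → ℂ} {V : Set E} (hV : IsOpen V) (hg : DifferentiableOn ℂ g V) {z v : E} (hz : z ∈ V)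
    (hgz : g z = 0) (hne : ¬ ∀ᶠ ζ : ℂ in 𝓝 0, g (z + ζ • v) = 0) {r : ℝ} (hr : 0 < r) :
    ∀ᶠ y in 𝓝 z, ∃ ζ : ℂ, ‖ζ‖ < r ∧ y + ζ • v ∈ V ∧ g (y + ζ • v) = 0 := by
  have hcont : Continuous fun p : E × ℂ => p.1 + p.2 • v := by fun_prop
  have hline : ∀ y : E, Continuous fun ζ : ℂ => y + ζ • v := fun y => by fun_prop
  have hVline : ∀ y : E, IsOpen {ζ : ℂ | y + ζ • v ∈ V} := fun y => hV.preimage (hline y)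
  have hdiff : ∀ y : E, DifferentiableOn ℂ (fun ζ : ℂ => g (y + ζ • v)) {ζ : ℂ | y + ζ • v ∈ V} :=
    fun y => hg.comp (by fun_prop) fun ζ hζ => hζ
  have h0 : (0 : ℂ) ∈ {ζ : ℂ | z + ζ • v ∈ V} := by simpa using hz
  have han : AnalyticAt ℂ (fun ζ : ℂ => g (z + ζ • v)) 0 :=
    (hdiff z).analyticAt ((hVline z).mem_nhds h0)
  have hnz : ∀ᶠ ζ in 𝓝[≠] (0 : ℂ), g (z + ζ • v) ≠ 0 :=
    han.eventually_eq_zero_or_eventually_ne_zero.resolve_left hne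
  obtain ⟨ε, hε, hball⟩ := Metric.eventually_nhds_iff_ball.1
    ((eventually_nhdsWithin_iff.1 hnz).and ((hVline z).mem_nhds h0))
  obtain ⟨ρ, hρ, hρ'⟩ := exists_between (lt_min hε hr)
  have hclosed : ∀ ζ ∈ Metric.closedBall (0 : ℂ) ρ, ζ ∈ Metric.ball (0 : ℂ) ε := fun ζ hζ =>
    Metric.closedBall_subset_ball (hρ'.trans_le (min_le_left _ _)) hζ
  -- On the circle of radius `ρ`, the values on nearby lines exceed the value at the centre.
  have hcircle : ∀ᶠ y in 𝓝 z, ∀ ζ ∈ Metric.sphere (0 : ℂ) ρ, ‖g y‖ < ‖g (y + ζ • v)‖ := by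
    refine (isCompact_sphere (0 : ℂ) ρ).eventually_forall_of_forall_eventually fun ζ hζ => ?_
    have hζb := hball ζ (hclosed ζ (Metric.sphere_subset_closedBall hζ))
    have hζ0 : ζ ≠ 0 := fun h => by simp [h] at hζ; exact hρ.ne hζ
    have h1 : ContinuousAt (fun p : E × ℂ => ‖g p.1‖) (z, ζ) :=
      ((hg.continuousOn.continuousAt (hV.mem_nhds hz)).comp continuousAt_fst).norm
    have h2 : ContinuousAt (fun p : E × ℂ => ‖g (p.1 + p.2 • v)‖) (z, ζ) :=
      (ContinuousAt.comp (f := fun p : E × ℂ => p.1 + p.2 • v)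
        (hg.continuousOn.continuousAt (hV.mem_nhds hζb.2)) hcont.continuousAt).norm
    refine h1.eventually_lt h2 ?_
    simpa [hgz] using hζb.1 hζ0
  have hdisc : ∀ᶠ y in 𝓝 z, ∀ ζ ∈ Metric.closedBall (0 : ℂ) ρ, y + ζ • v ∈ V := by
    refine (isCompact_closedBall (0 : ℂ) ρ).eventually_forall_of_forall_eventually fun ζ hζ => ?_
    exact hcont.continuousAt.eventually (hV.mem_nhds (hball ζ (hclosed ζ hζ)).2)
  filter_upwards [hcircle, hdisc] with y hy1 hy2
  by_contra! hcon
  have hnv : ∀ ζ ∈ Metric.closedBall (0 : ℂ) ρ, g (y + ζ • v) ≠ 0 := fun ζ hζ =>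
    hcon ζ ((mem_closedBall_zero_iff.1 hζ).trans_lt (hρ'.trans_le (min_le_right _ _))) (hy2 ζ hζ)
  -- Otherwise `1 / g` on the disc contradicts the maximum modulus principle.
  have hd : DiffContOnCl ℂ (fun ζ : ℂ => (g (y + ζ • v))⁻¹) (Metric.ball 0 ρ) := by
    refine DifferentiableOn.diffContOnCl ?_
    rw [closure_ball _ hρ.ne']
    exact ((hdiff y).mono hy2).inv hnv
  obtain ⟨ζ, hζ, hmax⟩ := Complex.exists_mem_frontier_isMaxOn_norm Metric.isBounded_ball
    (Metric.nonempty_ball.2 hρ) hd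
  rw [frontier_ball _ hρ.ne'] at hζ
  have hle := hmax (subset_closure (Metric.mem_ball_self hρ))
  have hg0 := hnv 0 (Metric.mem_closedBall_self hρ.le)
  simp only [mem_ofPred_eq, Function.comp, norm_inv, zero_smul, add_zero] at hle hg0
  exact absurd ((inv_le_inv₀ (norm_pos_iff.2 hg0) ((norm_nonneg _).trans_lt (hy1 ζ hζ))).1 hle)
    (not_le.2 (hy1 ζ hζ))

namespace ComplexTorus

variable {Λ : Submodule ℤ C2}

/-! ### The topology of the torus -/

theorem continuous_proj : Continuous (proj Λ) := QuotientAddGroup.continuous_mk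

theorem proj_add (y z : C2) : proj Λ (y + z) = proj Λ y + proj Λ z := rfl

theorem proj_eq_zero_iff {z : C2} : proj Λ z = 0 ↔ z ∈ Λ :=
  QuotientAddGroup.eq_zero_iff z

theorem proj_add_of_mem {z l : C2} (hl : l ∈ Λ) : proj Λ (z + l) = proj Λ z := by
  rw [proj_add, proj_eq_zero_iff.2 hl, add_zero]

theorem proj_eq_proj_iff {y z : C2} : proj Λ y = proj Λ z ↔ y - z ∈ Λ := by
  rw [← proj_eq_zero_iff, ← sub_eq_zero]; rfl

instance : ConnectedSpace (ComplexTorus Λ) :=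
  Function.Surjective.connectedSpace (f := proj Λ) QuotientAddGroup.mk_surjective continuous_proj

variable [DiscreteTopology Λ]

instance : IsClosed (Λ.toAddSubgroup : Set C2) :=
  have : DiscreteTopology Λ.toAddSubgroup := ‹DiscreteTopology Λ›
  AddSubgroup.isClosed_of_discrete

instance [IsZLattice ℝ Λ] : CompactSpace (ComplexTorus Λ) := by
  have h := IsZLattice.isCompact_range_of_periodic Λ (proj Λ) continuous_proj
    fun z w hw => proj_add_of_mem hw
  rwa [range_eq_univ.2 QuotientAddGroup.mk_surjective, isCompact_univ_iff] at h

theorem map_proj_nhds (z : C2) : map (proj Λ) (𝓝 z) = 𝓝 (proj Λ z) :=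
  (isCoveringMap_proj Λ).isLocalHomeomorph.map_nhds_eq z

/-! ### Local equations of a curve -/

theorem extChartAt_symm_apply (q : ComplexTorus Λ) (y : C2) :
    (extChartAt 𝓘(ℂ, C2) q).symm y = proj Λ y := by
  simp [extChartAt, chartAt, ChartedSpace.chartAt]

theorem proj_extChartAt {p q : ComplexTorus Λ} (h : q ∈ (extChartAt 𝓘(ℂ, C2) p).source) :
    proj Λ (extChartAt 𝓘(ℂ, C2) p q) = q := by
  rw [← extChartAt_symm_apply p, PartialEquiv.left_inv _ h]

/-- A function on the torus is holomorphic at a point only if its pullback to `ℂ²` is. -/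
theorem differentiableAt_comp_proj {g : ComplexTorus Λ → ℂ} {z : C2}
    (hg : MDifferentiableAt 𝓘(ℂ, C2) 𝓘(ℂ, ℂ) g (proj Λ z)) :
    DifferentiableAt ℂ (fun y => g (proj Λ y)) z := by
  have h := ((mdifferentiableAt_iff _ _).1 hg).2
  set y := extChartAt 𝓘(ℂ, C2) (proj Λ z) (proj Λ z) with hy
  have hl : y - z ∈ Λ := proj_eq_proj_iff.1 (proj_extChartAt (mem_extChartAt_source _))
  simp only [modelWithCornersSelf_coe, range_id, differentiableWithinAt_univ] at h
  have heq : (fun w => g (proj Λ w)) = fun w =>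
      writtenInExtChartAt 𝓘(ℂ, C2) 𝓘(ℂ, ℂ) (proj Λ z) g (w + (y - z)) := by
    ext w
    simp only [writtenInExtChartAt, Function.comp, extChartAt_symm_apply, proj_add_of_mem hl]
    rfl
  rw [heq]
  refine DifferentiableAt.comp z (g := writtenInExtChartAt 𝓘(ℂ, C2) 𝓘(ℂ, ℂ) (proj Λ z) g)
    (f := fun w => w + (y - z)) ?_ (by fun_prop)
  simpa using h

/-- Near each point, the preimage in `ℂ²` of a compact curve has a holomorphic equation. -/
theorem IsCompactCurve.exists_equation {S : Set (ComplexTorus Λ)} (hS : IsCompactCurve Λ S)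
    {z : C2} (hz : proj Λ z ∈ S) :
    ∃ V : Set C2, IsOpen V ∧ z ∈ V ∧ ∃ g : C2 → ℂ, DifferentiableOn ℂ g V ∧
      (¬ ∀ᶠ y in 𝓝 z, g y = 0) ∧ ∀ y ∈ V, proj Λ y ∈ S ↔ g y = 0 := by
  obtain ⟨U, hU, hzU, g, hg, hne, hSU⟩ := hS.2.2 _ hz
  refine ⟨proj Λ ⁻¹' U, hU.preimage continuous_proj, hzU, fun y => g (proj Λ y), ?_, ?_, ?_⟩
  · intro y hy
    exact (differentiableAt_comp_proj
      ((hg _ hy).mdifferentiableAt (hU.mem_nhds hy))).differentiableWithinAt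
  · rwa [← map_proj_nhds, eventually_map] at hne
  · intro y hy
    have := congrArg (proj Λ y ∈ ·) hSU
    simpa [show proj Λ y ∈ U from hy] using this

/-! ### Lines in a simple torus -/

/-- The linear form on `ℂ²` whose kernel is the line spanned by `v ≠ 0`. -/
noncomputable def lineForm (v : C2) : C2 →L[ℂ] ℂ :=
  v 1 • EuclideanSpace.proj (0 : Fin 2) - v 0 • EuclideanSpace.proj (1 : Fin 2)

theorem lineForm_apply (v z : C2) : lineForm v z = v 1 * z 0 - v 0 * z 1 := by
  simp [lineForm]

theorem exists_smul_of_lineForm_eq_zero {v : C2} (hv : v ≠ 0) {z : C2} (hz : lineForm v z = 0) :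
    ∃ ζ : ℂ, z = ζ • v := by
  rw [lineForm_apply] at hz
  by_cases h0 : v 0 = 0
  · have h1 : v 1 ≠ 0 := fun h1 => hv (by ext i; fin_cases i <;> simp [h0, h1])
    have hz0 : z 0 = 0 := by simpa [h0, h1] using hz
    refine ⟨z 1 / v 1, ?_⟩
    ext i
    fin_cases i
    · simp [h0, hz0]
    · simp [h1]
  · refine ⟨z 0 / v 0, ?_⟩
    ext i
    fin_cases i
    · simp [h0]
    · simp only [Fin.mk_one, PiLp.smul_apply, smul_eq_mul]
      field_simp
      linear_combination -hz

theorem exists_lineForm_eq_one {v : C2} (hv : v ≠ 0) : ∃ u : C2, lineForm v u = 1 := by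
  by_cases h0 : v 0 = 0
  · have h1 : v 1 ≠ 0 := fun h1 => hv (by ext i; fin_cases i <;> simp [h0, h1])
    exact ⟨!₂[(v 1)⁻¹, 0], by simp [lineForm_apply, h1]⟩
  · exact ⟨!₂[0, -(v 0)⁻¹], by simp [lineForm_apply, h0]⟩

theorem lineForm_self (v : C2) : lineForm v v = 0 := by
  rw [lineForm_apply]; ring

/-- In a simple torus, the image of a line through the origin is not compact: it would be a
one-dimensional subtorus. -/
theorem IsSimple.not_isCompact_line (hT : IsSimple Λ) {v : C2} (hv : v ≠ 0) :
    ¬ IsCompact (range fun ζ : ℂ => proj Λ (ζ • v)) := by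
  intro hc
  have : Countable Λ := TopologicalSpace.separableSpace_iff_countable.1 inferInstance
  have hW : (range fun ζ : ℂ => proj Λ (ζ • v)) = proj Λ '' ((ℂ ∙ v : Submodule ℂ C2) : Set C2) := by
    ext x
    simp [Submodule.mem_span_singleton]
  rcases hT _ ⟨⟨_, hW⟩, hc⟩ with h | h
  · -- The whole line cannot lie in the discrete group `Λ`.
    have hmem : ∀ ζ : ℂ, ζ • v ∈ Λ := fun ζ =>
      proj_eq_zero_iff.1 (h.subset (mem_range_self ζ))
    let j : ℂ → Λ := fun ζ => ⟨ζ • v, hmem ζ⟩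
    have hj : Function.Injective j := fun a b hab =>
      smul_left_injective ℂ hv (congrArg Subtype.val hab)
    exact not_countable_complex (Set.countable_univ_iff.2 hj.countable)
  · -- Countably many translates of the line cannot cover `ℂ²`.
    obtain ⟨u, hu⟩ := exists_lineForm_eq_one hv
    have hsurj : Function.Surjective fun l : Λ => lineForm v l := by
      intro w
      obtain ⟨ζ, hζ⟩ := h.ge (mem_univ (proj Λ (w • u)))
      refine ⟨⟨_, proj_eq_proj_iff.1 hζ.symm⟩, ?_⟩
      simp [lineForm_self, hu]
    exact not_countable_complex (Set.countable_univ_iff.2 hsurj.countable)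

/-- In a simple torus, the parallel translates of a line by the lattice accumulate at the line. -/
theorem IsSimple.frequently_mem_lineForm_image [IsZLattice ℝ Λ] (hT : IsSimple Λ) {v : C2}
    (hv : v ≠ 0) : ∃ᶠ w in 𝓝[≠] (0 : ℂ), ∃ l ∈ Λ, lineForm v l = w := by
  intro hdisc
  refine hT.not_isCompact_line hv (IsClosed.isCompact ?_)
  let G : AddSubgroup ℂ := Λ.toAddSubgroup.map (lineForm v).toLinearMap.toAddMonoidHom
  have hG : ∀ w, w ∈ G ↔ ∃ l ∈ Λ, lineForm v l = w := fun w => Iff.rfl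
  have : DiscreteTopology G := by
    refine discreteTopology_of_isOpen_singleton_zero ?_
    rw [isOpen_iff_mem_nhds]
    rintro _ rfl
    rw [nhds_subtype_eq_comap, mem_comap]
    refine ⟨_, eventually_nhdsWithin_iff.1 hdisc, ?_⟩
    rintro ⟨w, hw⟩ hw'
    by_contra hne
    exact hw' (fun h : w = 0 => hne (Subtype.ext h)) ((hG w).1 hw)
  have hGc : IsClosed (G : Set ℂ) := AddSubgroup.isClosed_of_discrete
  have hquot : Topology.IsQuotientMap (proj Λ) := QuotientAddGroup.isQuotientMap_mk _
  rw [← hquot.isClosed_preimage]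
  convert! hGc.preimage (lineForm v).continuous using 1
  ext z
  constructor
  · rintro ⟨ζ, hζ⟩
    refine (hG _).2 ⟨_, proj_eq_proj_iff.1 hζ.symm, ?_⟩
    simp [lineForm_self]
  · rintro hz
    obtain ⟨l, hl, hlz⟩ := (hG _).1 hz
    obtain ⟨ζ, hζ⟩ := exists_smul_of_lineForm_eq_zero hv (z := z - l) (by simp [hlz])
    refine ⟨ζ, ?_⟩
    simp only [← hζ]
    exact proj_eq_proj_iff.2 (by simpa using hl)

/-! ### Intersections of lines with a curve -/

/-- By the identity theorem, a line that lies in a curve near one point lies in it entirely. -/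
theorem IsCompactCurve.line_mem_of_eventually {S : Set (ComplexTorus Λ)} (hS : IsCompactCurve Λ S)
    {z v : C2} (h : ∀ᶠ ζ : ℂ in 𝓝 0, proj Λ (z + ζ • v) ∈ S) (ζ : ℂ) :
    proj Λ (z + ζ • v) ∈ S := by
  have hline : Continuous fun ζ : ℂ => z + ζ • v := by fun_prop
  have hSc : IsClosed {ζ : ℂ | proj Λ (z + ζ • v) ∈ S} :=
    hS.2.1.isClosed.preimage (continuous_proj.comp hline)
  let A : Set ℂ := {ζ | ∀ᶠ ξ in 𝓝 ζ, proj Λ (z + ξ • v) ∈ S}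
  have hAo : IsOpen A := isOpen_setOfPred_eventually_nhds
  have hAS : ∀ ζ ∈ A, proj Λ (z + ζ • v) ∈ S := fun ζ hζ => hζ.self_of_nhds
  have hAc : IsClosed A := by
    refine isClosed_of_closure_subset fun ζ hζ => ?_
    have hζS : proj Λ (z + ζ • v) ∈ S := (closure_minimal hAS hSc) hζ
    obtain ⟨V, hV, hzV, g, hg, -, hgS⟩ := hS.exists_equation hζS
    have hVo : IsOpen {ξ : ℂ | z + ξ • v ∈ V} := hV.preimage hline
    have han : AnalyticAt ℂ (fun ξ : ℂ => g (z + ξ • v)) ζ :=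
      DifferentiableOn.analyticAt (s := {ξ : ℂ | z + ξ • v ∈ V})
        (hg.comp (by fun_prop) fun ξ hξ => hξ) (hVo.mem_nhds hzV)
    have hVev : ∀ᶠ ξ in 𝓝 ζ, z + ξ • v ∈ V := hVo.mem_nhds hzV
    rcases han.eventually_eq_zero_or_eventually_ne_zero with h0 | h0
    · filter_upwards [h0, hVev] with ξ h1 h2 using (hgS _ h2).2 h1
    · -- An isolated zero cannot be adherent to the open set `A` of zeros.
      exfalso
      have hnot : ∀ᶠ ξ in 𝓝[≠] ζ, ξ ∉ A := by
        filter_upwards [h0, nhdsWithin_le_nhds hVev] with ξ h1 h2 h3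
        exact h1 ((hgS _ h2).1 (hAS ξ h3))
      obtain ⟨W, hW, hWo, hζW⟩ := eventually_nhds_iff.1 (eventually_nhdsWithin_iff.1 hnot)
      obtain ⟨ξ, hξW, hξA⟩ := mem_closure_iff.1 hζ W hWo hζW
      have hsub : W ∩ A ⊆ {ζ} := fun x hx => by
        by_contra hne
        exact hW x hx.1 hne hx.2
      have hξ : ξ = ζ := hsub ⟨hξW, hξA⟩
      have hmem : W ∩ A ∈ 𝓝[≠] ξ :=
        nhdsWithin_le_nhds ((hWo.inter hAo).mem_nhds ⟨hξW, hξA⟩)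
      obtain ⟨x, hx, hxne⟩ := (inter_mem hmem self_mem_nhdsWithin |>
        (NormedField.nhdsNE_neBot ξ).nonempty_of_mem)
      exact hxne ((hsub hx).trans hξ.symm)
  have : A = univ := IsClopen.eq_univ ⟨hAc, hAo⟩ ⟨0, h⟩
  exact hAS ζ (this ▸ mem_univ ζ)

/-- In a simple torus, no line lies in a curve, not even locally. The curve would contain the
translates of the line by the lattice, which accumulate at the line, and the local equation of the
curve would vanish identically. -/
theorem IsCompactCurve.not_eventually_line_mem [IsZLattice ℝ Λ] (hT : IsSimple Λ)
    {S : Set (ComplexTorus Λ)} (hS : IsCompactCurve Λ S) {v : C2} (hv : v ≠ 0) (z : C2) :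
    ¬ ∀ᶠ ζ : ℂ in 𝓝 0, proj Λ (z + ζ • v) ∈ S := by
  intro h
  have hline := hS.line_mem_of_eventually h
  obtain ⟨V, hV, hzV, g, hg, hne, hgS⟩ :=
    hS.exists_equation (z := z) (by simpa using hline 0)
  refine hne ?_
  obtain ⟨u, hu⟩ := exists_lineForm_eq_one hv
  obtain ⟨ε, hε, hball⟩ := Metric.isOpen_iff.1 hV z hzV
  -- `y - lineForm v (y - z) • u` is the projection of `y` along `u` to the line through `z`.
  have hcont : Continuous fun y : C2 => y - lineForm v (y - z) • u := by fun_prop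
  have hev : ∀ᶠ y in 𝓝 z, y - lineForm v (y - z) • u ∈ Metric.ball z ε :=
    hcont.continuousAt.preimage_mem_nhds (by simpa using Metric.ball_mem_nhds z hε)
  filter_upwards [hev, Metric.ball_mem_nhds z hε] with y hy1 hy2
  set y₀ := y - lineForm v (y - z) • u with hy₀
  let B : Set ℂ := {w | y₀ + w • u ∈ Metric.ball z ε}
  have hBo : IsOpen B := Metric.isOpen_ball.preimage (by fun_prop)
  have hBc : IsPreconnected B := by
    refine Convex.isPreconnected ?_
    intro a ha b hb s t hs ht hst
    have := (convex_ball z ε) ha hb hs ht hst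
    have hid : y₀ + (s • a + t • b) • u = s • (y₀ + a • u) + t • (y₀ + b • u) := by
      have : y₀ = (s + t) • y₀ := by rw [hst, one_smul]
      nth_rewrite 1 [this]
      simp only [add_smul, smul_add, smul_assoc]
      abel
    simpa only [B, mem_ofPred_eq, hid] using this
  have han : AnalyticOnNhd ℂ (fun w : ℂ => g (y₀ + w • u)) B :=
    DifferentiableOn.analyticOnNhd (hg.comp (by fun_prop) fun w hw => hball hw) hBo
  have h0B : (0 : ℂ) ∈ B := by simpa [B] using hy1
  have hfreq : ∃ᶠ w in 𝓝[≠] (0 : ℂ), g (y₀ + w • u) = 0 := by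
    refine ((hT.frequently_mem_lineForm_image hv).and_eventually
      (nhdsWithin_le_nhds (hBo.mem_nhds h0B))).mono ?_
    rintro w ⟨⟨l, hl, hlw⟩, hwB⟩
    refine (hgS _ (hball hwB)).1 ?_
    obtain ⟨ζ, hζ⟩ := exists_smul_of_lineForm_eq_zero hv (z := y₀ + w • u - z - l) (by
      simp only [hy₀, map_sub, map_add, map_smul, hu, hlw, smul_eq_mul]; ring)
    have : y₀ + w • u = z + ζ • v + l := by rw [← hζ]; abel
    rw [this, proj_add_of_mem hl]
    exact hline ζ
  have hyB : lineForm v (y - z) ∈ B := by simpa [B, hy₀] using hy2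
  have := han.eqOn_zero_of_preconnected_of_frequently_eq_zero hBc h0B hfreq hyB
  simpa [hy₀] using this

/-- In a simple torus, an intersection point of a line and a curve persists on nearby parallel
lines. -/
theorem IsCompactCurve.eventually_exists_line_mem [IsZLattice ℝ Λ] (hT : IsSimple Λ)
    {S : Set (ComplexTorus Λ)} (hS : IsCompactCurve Λ S) {v : C2} (hv : v ≠ 0)
    {p : ComplexTorus Λ} (hp : p ∈ S) {r : ℝ} (hr : 0 < r) :
    ∀ᶠ q in 𝓝 p, ∃ ζ : ℂ, ‖ζ‖ < r ∧ q + proj Λ (ζ • v) ∈ S := by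
  obtain ⟨z, rfl⟩ := QuotientAddGroup.mk_surjective p
  obtain ⟨V, hV, hzV, g, hg, -, hgS⟩ := hS.exists_equation hp
  have hVo : IsOpen {ξ : ℂ | z + ξ • v ∈ V} := hV.preimage (by fun_prop)
  have hne : ¬ ∀ᶠ ζ : ℂ in 𝓝 0, g (z + ζ • v) = 0 := by
    intro h
    refine hS.not_eventually_line_mem hT hv z ?_
    filter_upwards [h, hVo.mem_nhds (by simpa using hzV)] with ζ h1 h2 using (hgS _ h2).2 h1
  change ∀ᶠ q in 𝓝 (proj Λ z), _
  rw [← map_proj_nhds, eventually_map]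
  filter_upwards [eventually_exists_zero_on_line hV hg hzV ((hgS z hzV).1 hp) hne hr]
    with y ⟨ζ, hζ, hyV, hgy⟩
  exact ⟨ζ, hζ, (hgS _ hyV).2 hgy⟩

/-- In a simple torus, every line meets every curve. The union `S + L` of the lines parallel to
`L` that meet `S` is open because intersection points persist, hence equal to `S + closure L`, which
is closed as `S` is compact; and the torus is connected. -/
theorem IsCompactCurve.exists_line_mem [IsZLattice ℝ Λ] (hT : IsSimple Λ)
    {S : Set (ComplexTorus Λ)} (hS : IsCompactCurve Λ S) {v : C2} (hv : v ≠ 0)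
    (x : ComplexTorus Λ) : ∃ ζ : ℂ, x + proj Λ (ζ • v) ∈ S := by
  let L : Set (ComplexTorus Λ) := range fun ζ : ℂ => proj Λ (ζ • v)
  have hLL : L + L ⊆ L := by
    rintro _ ⟨_, ⟨a, rfl⟩, _, ⟨b, rfl⟩, rfl⟩
    exact ⟨a + b, by simp only [add_smul]; rfl⟩
  have hmem : ∀ y, y ∈ S + L ↔ ∃ ζ : ℂ, y + proj Λ (ζ • v) ∈ S := by
    intro y
    constructor
    · rintro ⟨s, hs, _, ⟨ζ, rfl⟩, rfl⟩
      refine ⟨-ζ, ?_⟩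
      have : proj Λ ((-ζ) • v) = - proj Λ (ζ • v) := by rw [neg_smul]; rfl
      simpa [this] using hs
    · rintro ⟨ζ, hζ⟩
      refine ⟨_, hζ, proj Λ ((-ζ) • v), mem_range_self _, ?_⟩
      simp
  have hopen : IsOpen (S + L) := by
    rw [isOpen_iff_mem_nhds]
    intro y hy
    obtain ⟨ζ, hζ⟩ := (hmem y).1 hy
    have ht : Tendsto (· + proj Λ (ζ • v)) (𝓝 y) (𝓝 (y + proj Λ (ζ • v))) :=
      (continuous_add_const _).tendsto y
    filter_upwards [ht.eventually (hS.eventually_exists_line_mem hT hv hζ one_pos)]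
      with q ⟨ξ, _, hξ⟩
    refine (hmem q).2 ⟨ζ + ξ, ?_⟩
    rw [add_smul, proj_add, ← add_assoc]
    exact hξ
  have hclosure : S + L = S + closure L := by
    refine (add_subset_add_left subset_closure).antisymm ?_
    have h0 : (0 : ComplexTorus Λ) ∈ L := ⟨0, by simp only [zero_smul]; rfl⟩
    calc S + closure L ⊆ (S + L) + closure L :=
          add_subset_add_right fun s hs => ⟨s, hs, 0, h0, add_zero s⟩
      _ = S + (L + L) := by rw [hopen.add_closure, add_assoc]
      _ ⊆ S + L := add_subset_add_left hLL
  have hclosed : IsClosed (S + L) := by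
    rw [hclosure]
    exact isClosed_closure.add_left_of_isCompact hS.2.1
  obtain ⟨s, hs⟩ := hS.1
  have huniv : S + L = univ := IsClopen.eq_univ ⟨hclosed, hopen⟩
    ⟨s + proj Λ ((0 : ℂ) • v), s, hs, _, mem_range_self _, rfl⟩
  exact (hmem x).1 (huniv ▸ mem_univ x)

/-- In a simple torus, every line meets every curve in infinitely many points. If there were only
finitely many, then arbitrarily large discs of the line would avoid the curve, and so would a line
in their limit. -/
theorem IsCompactCurve.infinite_range_line_inter [IsZLattice ℝ Λ] (hT : IsSimple Λ)
    {S : Set (ComplexTorus Λ)} (hS : IsCompactCurve Λ S) {v : C2} (hv : v ≠ 0)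
    (x : ComplexTorus Λ) : ((range fun ζ : ℂ => x + proj Λ (ζ • v)) ∩ S).Infinite := by
  intro hfin
  set F := (range fun ζ : ℂ => x + proj Λ (ζ • v)) ∩ S with hF
  have hdiscs : ∀ R : ℝ, ∃ ζ : ℂ, ∀ ξ : ℂ, ‖ξ‖ ≤ R → x + proj Λ ((ζ + ξ) • v) ∉ S := by
    intro R
    by_contra! hcon
    -- Otherwise the line is the compact set `F + D`, where `D` is its disc of radius `R`.
    let D : Set (ComplexTorus Λ) := (fun ξ : ℂ => proj Λ (ξ • v)) '' Metric.closedBall 0 R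
    have hD : IsCompact D := (isCompact_closedBall _ _).image
      (continuous_proj.comp (by fun_prop))
    have hK : IsCompact ((F + D) + {-x}) := (hfin.isCompact.add hD).add isCompact_singleton
    refine hT.not_isCompact_line hv ?_
    convert hK using 1
    ext y
    constructor
    · rintro ⟨ζ, rfl⟩
      obtain ⟨ξ, hξ, hmem⟩ := hcon ζ
      refine ⟨_, ⟨_, ⟨⟨ζ + ξ, rfl⟩, hmem⟩, _, ⟨-ξ, by simpa using hξ, rfl⟩, rfl⟩, -x, rfl, ?_⟩
      have : proj Λ (ζ • v) = proj Λ ((ζ + ξ) • v) + proj Λ ((-ξ) • v) := by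
        rw [← proj_add, ← add_smul]; simp
      simp only [this]
      abel
    · rintro ⟨_, ⟨_, ⟨⟨ζ, rfl⟩, -⟩, _, ⟨ξ, -, rfl⟩, rfl⟩, _, rfl, rfl⟩
      refine ⟨ζ + ξ, ?_⟩
      simp only [add_smul, proj_add]
      abel
  choose c hc using fun n : ℕ => hdiscs n
  obtain ⟨b, hb⟩ := exists_clusterPt_of_compactSpace
    (map (fun n => x + proj Λ (c n • v)) atTop)
  obtain ⟨ζ, hζ⟩ := hS.exists_line_mem hT hv b
  have ht : Tendsto (· + proj Λ (ζ • v)) (𝓝 b) (𝓝 (b + proj Λ (ζ • v))) :=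
    (continuous_add_const _).tendsto b
  have hfreq := (mapClusterPt_iff_frequently.1 hb) _
    (ht.eventually (hS.eventually_exists_line_mem hT hv hζ one_pos))
  obtain ⟨n, ⟨ξ, hξ, hmem⟩, hn⟩ :=
    (hfreq.and_eventually (eventually_ge_atTop ⌈‖ζ‖ + 1⌉₊)).exists
  refine hc n (ζ + ξ) ?_ ?_
  · calc ‖ζ + ξ‖ ≤ ‖ζ‖ + ‖ξ‖ := norm_add_le _ _
      _ ≤ ‖ζ‖ + 1 := by gcongr
      _ ≤ n := Nat.ceil_le.1 hn
  · simpa only [add_smul, proj_add, add_assoc] using hmem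

/-! ### Brody curves are lines -/

/-- The velocity of a holomorphic curve is the derivative of any of its continuous lifts. -/
theorem hasDerivAt_lift {f : ℂ → ComplexTorus Λ} {F : ℂ → C2} (hF : Continuous F)
    (hFf : ∀ ζ, proj Λ (F ζ) = f ζ) {ζ : ℂ} (hf : MDifferentiableAt 𝓘(ℂ, ℂ) 𝓘(ℂ, C2) f ζ) :
    HasDerivAt F (velocity f ζ) ζ := by
  set e := extChartAt 𝓘(ℂ, C2) (f ζ) with he
  let f' : ℂ →L[ℂ] C2 := mfderiv 𝓘(ℂ, ℂ) 𝓘(ℂ, C2) f ζ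
  have hd : HasFDerivAt (fun ξ => e (f ξ)) f' ζ :=
    hasFDerivWithinAt_univ.1 (by simpa only [modelWithCornersSelf_coe, range_id] using!
      hf.hasMFDerivAt.2)
  have hfc : ContinuousAt f ζ := hf.continuousAt
  have hsrc : ∀ᶠ ξ in 𝓝 ζ, f ξ ∈ e.source :=
    hfc.eventually (extChartAt_source_mem_nhds (I := 𝓘(ℂ, C2)) (f ζ))
  have hmem : ∀ᶠ ξ in 𝓝 ζ, e (f ξ) - F ξ ∈ Λ := by
    filter_upwards [hsrc] with ξ hξ
    exact proj_eq_proj_iff.1 ((proj_extChartAt hξ).trans (hFf ξ).symm)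
  have hcont : ContinuousAt (fun ξ => e (f ξ) - F ξ) ζ := hd.continuousAt.sub hF.continuousAt
  have htend : Tendsto (fun ξ => e (f ξ) - F ξ) (𝓝 ζ) (pure (e (f ζ) - F ζ)) := by
    have : DiscreteTopology (Λ : Set C2) := ‹DiscreteTopology Λ›
    rw [← nhdsWithin_of_mem_discrete (s := (Λ : Set C2)) ⟨this⟩ hmem.self_of_nhds]
    exact tendsto_nhdsWithin_iff.2 ⟨hcont, hmem⟩
  have hEq : F =ᶠ[𝓝 ζ] fun ξ => e (f ξ) - (e (f ζ) - F ζ) := by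
    filter_upwards [tendsto_pure.1 htend] with ξ hξ
    rw [← hξ, sub_sub_cancel]
  exact (hd.hasDerivAt.sub_const _).congr_of_eventuallyEq hEq

/-- By compactness, the length for a Hermitian metric dominates the norm of `ℂ²`. -/
theorem HermitianMetric.exists_norm_le_length [IsZLattice ℝ Λ] (h : HermitianMetric Λ) :
    ∃ c : ℝ, 0 < c ∧ ∀ x v, c * ‖v‖ ≤ h.length x v := by
  have hform : Continuous h.form := h.smooth.continuous
  have hcont : Continuous fun p : ComplexTorus Λ × C2 => h.length p.1 p.2 := by
    have h1 : Continuous fun p : ComplexTorus Λ × C2 => h.form p.1 p.2 :=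
      ((ContinuousLinearMap.apply' (C2 →L[ℂ] ℂ) (starRingEnd ℂ)).continuous.comp
        continuous_snd).clm_apply (hform.comp continuous_fst)
    exact (Complex.continuous_re.comp (h1.clm_apply continuous_snd)).sqrt
  have hK : IsCompact ((univ : Set (ComplexTorus Λ)) ×ˢ Metric.sphere (0 : C2) 1) :=
    isCompact_univ.prod (isCompact_sphere 0 1)
  have hne : ((univ : Set (ComplexTorus Λ)) ×ˢ Metric.sphere (0 : C2) 1).Nonempty :=
    univ_nonempty.prod (NormedSpace.sphere_nonempty.2 zero_le_one)
  obtain ⟨⟨x₀, v₀⟩, ⟨-, hv₀⟩, hmin⟩ := hK.exists_isMinOn hne hcont.continuousOn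
  have hv₀' : v₀ ≠ 0 := fun h0 => by simp [h0] at hv₀
  refine ⟨h.length x₀ v₀, Real.sqrt_pos.2 (h.pos _ _ hv₀'), fun x v => ?_⟩
  rcases eq_or_ne v 0 with rfl | hv
  · simp [HermitianMetric.length]
  have hvn : 0 < ‖v‖ := norm_pos_iff.2 hv
  set u : C2 := ((‖v‖⁻¹ : ℝ) : ℂ) • v with hu
  have hu1 : ‖u‖ = 1 := by
    rw [hu, norm_smul, Complex.norm_real, norm_inv, norm_norm, inv_mul_cancel₀ hvn.ne']
  have hle : h.length x₀ v₀ ≤ h.length x u :=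
    hmin (mk_mem_prod (mem_univ x) (mem_sphere_zero_iff_norm.2 hu1))
  have hscale : h.length x u = ‖v‖⁻¹ * h.length x v := by
    rw [HermitianMetric.length, HermitianMetric.length, hu]
    have : (h.form x (((‖v‖⁻¹ : ℝ) : ℂ) • v) (((‖v‖⁻¹ : ℝ) : ℂ) • v)).re
        = ‖v‖⁻¹ ^ 2 * (h.form x v v).re := by
      simp only [map_smulₛₗ, smul_apply, Complex.conj_ofReal,
        smul_eq_mul, Complex.re_ofReal_mul, RingHom.id_apply]
      ring
    rw [this, Real.sqrt_mul (by positivity), Real.sqrt_sq (by positivity)]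
  calc h.length x₀ v₀ * ‖v‖ ≤ ‖v‖⁻¹ * h.length x v * ‖v‖ := by
        rw [← hscale]; gcongr
    _ = h.length x v := by field_simp

/-- A Brody curve in a torus is the image of an affine line: its lift to `ℂ²` has a bounded
derivative, which is constant by Liouville's theorem. -/
theorem IsBrodyCurve.exists_eq_line [IsZLattice ℝ Λ] {h : HermitianMetric Λ}
    {f : ℂ → ComplexTorus Λ} (hf : IsBrodyCurve h f) :
    ∃ v : C2, v ≠ 0 ∧ ∀ ζ, f ζ = f 0 + proj Λ (ζ • v) := by
  obtain ⟨z₀, hz₀⟩ := QuotientAddGroup.mk_surjective (f 0)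
  obtain ⟨F, ⟨-, hF⟩, -⟩ := (isCoveringMap_proj Λ).existsUnique_continuousMap_lifts
    ⟨f, hf.holomorphic.continuous⟩ 0 z₀ hz₀
  have hFf : ∀ ζ, proj Λ (F ζ) = f ζ := congrFun hF
  have hderiv : ∀ ζ, HasDerivAt F (velocity f ζ) ζ := fun ζ =>
    hasDerivAt_lift F.continuous hFf (hf.holomorphic ζ)
  have hdiff : Differentiable ℂ F := fun ζ => (hderiv ζ).differentiableAt
  obtain ⟨c, hc, hle⟩ := h.exists_norm_le_length
  have hbdd : Bornology.IsBounded (range (deriv F)) := by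
    refine isBounded_iff_forall_norm_le.2 ⟨h.length (f 0) (velocity f 0) / c, ?_⟩
    rintro _ ⟨ζ, rfl⟩
    rw [(hderiv ζ).deriv, le_div_iff₀' hc]
    exact (hle _ _).trans (hf.bound ζ)
  set v := deriv F 0 with hv
  have hconst : ∀ ζ, deriv F ζ = v := fun ζ =>
    (hdiff.deriv).apply_eq_apply_of_bounded hbdd ζ 0
  have hline : ∀ ζ, F ζ = F 0 + ζ • v := by
    have hd : ∀ ζ, HasDerivAt (fun ζ => F ζ - ζ • v) 0 ζ := fun ζ => by
      have h1 := (hdiff ζ).hasDerivAt.sub ((hasDerivAt_id ζ).smul_const v)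
      rw [hconst, one_smul, sub_self] at h1
      exact h1
    intro ζ
    have := is_const_of_deriv_eq_zero (fun ξ => (hd ξ).differentiableAt)
      (fun ξ => (hd ξ).deriv) ζ 0
    rw [zero_smul, sub_zero] at this
    exact sub_eq_iff_eq_add.1 this
  have hfline : ∀ ζ, f ζ = f 0 + proj Λ (ζ • v) := fun ζ => by
    rw [← hFf ζ, ← hFf 0, ← proj_add, ← hline]
  refine ⟨v, fun h0 => hf.nonconstant ⟨f 0, fun ζ => ?_⟩, hfline⟩
  rw [hfline ζ, h0, smul_zero]
  exact add_zero _

end ComplexTorus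

theorem proposition3p3 (Λ : Submodule ℤ C2) [DiscreteTopology Λ] [IsZLattice ℝ Λ]
    (hT : ComplexTorus.IsSimple Λ) (h : ComplexTorus.HermitianMetric Λ)
    (S : Set (ComplexTorus Λ)) (hS : ComplexTorus.IsCompactCurve Λ S) :
    (∀ f : ℂ → ComplexTorus Λ, ComplexTorus.IsBrodyCurve h f →
      (Set.range f ∩ S).Infinite) ∧
    (∀ D : Set (ComplexTorus Λ), D.Finite →
      ComplexTorus.HyperbolicNonPercolation h Sᶜ D) := by
  have hinf : ∀ f : ℂ → ComplexTorus Λ, ComplexTorus.IsBrodyCurve h f →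
      (Set.range f ∩ S).Infinite := by
    intro f hf
    obtain ⟨v, hv, hfv⟩ := hf.exists_eq_line
    rw [funext hfv]
    exact hS.infinite_range_line_inter hT hv (f 0)
  refine ⟨hinf, fun D hD => ?_⟩
  rintro ⟨g, hg, hgD⟩
  exact hinf g hg (hD.subset fun x hx => (hgD hx.1).resolve_left fun hxS => hxS hx.2)
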